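/- A semiring$^\dagger$ is a set with an associative commutative addition and a multiplicative monoid structure, multiplication being distributive over addition on both sides (no zero element is required). Let $L$ be a semiring$^\dagger$ with a designated sub-semiring$^\dagger$ $L_+\ni 1$ of positive elements, such that $\ell+p_1+p_2=\ell$ with $p_1,p_2\in L_+$ implies $\ell+p_1=\ell$; write $\ell\ge k$ if $\ell=k$ or $\ell=k+p$ for some $p\in L_+$, and call $\ell$ infinite if $\ell+p=\ell$ for some $p\in L_+$. An $L$-quasi-layered domain$^\dagger$ is a commutative semiring$^\dagger$ $R$ that is a disjoint union of layers $R_\ell$ $(\ell\in L)$, with maps $\nu_{m,\ell}:R_\ell\to R_m$ for $m\ge\ell$ satisfying $\nu_{\ell,\ell}=\mathrm{id}$ and $\nu_{m,\ell}\nu_{\ell,k}=\nu_{m,k}$, subject to the following axioms. For $a\in R_k$ and $b\in R_\ell$ write $a\cong_\nu b$ if $\nu_{m,k}(a)=\nu_{m,\ell}(b)$ for some $m\ge k,\ell$. (A1) $1_R\in R_1$. (A2) $R_kR_\ell\subseteq R_{k\ell}$. (A3) If $a\in R_k$, $b\in R_\ell$, $m\ge k$ and $m'\ge\ell$, then $\nu_{m,k}(a)\,\nu_{m',\ell}(b)=\nu_{mm',k\ell}(ab)$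 when $mm'\ge k\ell$, and $\nu_{k\ell,mm'}\big(\nu_{m,k}(a)\,\nu_{m',\ell}(b)\big)=ab$ when $k\ell\ge mm'$. (For $k,\ell\in L_+$ one always has $mm'\ge k\ell$.) (A4) $\nu_{\ell,k}(a)+\nu_{\ell',k}(a)=\nu_{\ell+\ell',k}(a)$ for $a\in R_k$ whenever $\ell,\ell',\ell+\ell'\ge k$. (B) If $a\in R_k$, $b\in R_\ell$ and $a\cong_\nu b$, then $a+b\in R_{k+\ell}$ and $a+b\cong_\nu a$; if moreover $k\in L_+$ is infinite, then $a+b=a$. Write $a\le_\nu b$ if $a+b\cong_\nu b$, and $a<_\nu b$ if $a\le_\nu b$ and $a\not\cong_\nu b$. Then $R$ is an $L$-layered domain$^\dagger$ if it is $\nu$-bipotent: $\cong_\nu$ respects addition, $a\not\cong_\nu b$ implies $a<_\nu b$ or $b<_\nu a$, and $a<_\nu b$ implies $a+b=b$. It is an $L$-layered $1$-semifield$^\dagger$ if in addition $(R_1,\cdot)$ is a group, and it is uniform if $L$ is totally ordered by $\ge$ and all maps $\nu_{m,\ell}$ are bijective. Adjoin to $R$ an absorbing additive identity $0$, which is $\nu$-equivalent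 only to itself. A polynomial over $R$ is a nonempty finite sum of monomials $\alpha\lambda^i$ with $\alpha\in R$ and $i\ge 0$, its missing coefficients being $0$; polynomials are added and multiplied formally. For $f=\sum_{i=0}^m\alpha_i\lambda^i$ and $g=\sum_{j=0}^n\beta_j\lambda^j$ of degrees $m,n\ge1$, the layered resultant $|\Re(f,g)|\in R\cup\{0\}$ is the permanent of the $(m+n)\times(m+n)$ Sylvester matrix, whose first $n$ rows are the successive right shifts of $(\alpha_0,\dots,\alpha_m,0,\dots,0)$ and whose last $m$ rows are the successive right shifts of $(\beta_0,\dots,\beta_n,0,\dots,0)$. If $f$ is constant, $|\Re(f,g)|:=\alpha_0^{\,n}$; if $g$ is constant, $|\Re(f,g)|:=\beta_0^{\,m}$. **Theorem.** Let $R$ be a uniform $L$-layered $1$-semifield$^\dagger$. Then any polynomials $f,g,h$ in one indeterminate over $R$ satisfy $$|\Re(f,gh)|\cong_\nu|\Re(f,g)|\,|\Re(f,h)|\qquad\text{and}\qquad|\Re(fg,h)|\cong_\nu|\Re(f,h)|\,|\Re(g,h)|.$$ -/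

import Mathlib

open Polynomial

/-- A semiring without zero (a "semiring†"): an additive commutative semigroup and a
multiplicative monoid, multiplication distributing over addition on both sides. -/
class SemiringDagger (R : Type*) extends Distrib R, AddCommSemigroup R, Monoid R

/-- A commutative semiring without zero. -/
class CommSemiringDagger (R : Type*) extends SemiringDagger R, CommMonoid R

/-- Formally adjoining an absorbing additive identity `0` to a commutative semiring without zero
gives a commutative semiring. -/
instance WithZero.instCommSemiringOfDagger {R : Type*} [CommSemiringDagger R] :
    CommSemiring (WithZero R) where
  left_distrib := left_distrib
  right_distrib := right_distrib
  zero_mul := zero_mul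
  mul_zero := mul_zero
  add_comm := add_comm
  mul_comm := mul_comm
  nsmul := nsmulRec

/-- A sorting semiring†: a semiring† `L` with a designated sub-semiring† `L₊` of positive elements,
such that `ℓ + p₁ + p₂ = ℓ` with `p₁, p₂ ∈ L₊` forces `ℓ + p₁ = ℓ`. -/
class SortingSemiring (L : Type*) extends SemiringDagger L where
  /-- the set `L₊` of positive elements -/
  pos : Set L
  one_mem_pos : (1 : L) ∈ pos
  add_mem_pos : ∀ {p q : L}, p ∈ pos → q ∈ pos → p + q ∈ pos
  mul_mem_pos : ∀ {p q : L}, p ∈ pos → q ∈ pos → p * q ∈ pos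
  add_pos_cancel : ∀ {l p q : L}, p ∈ pos → q ∈ pos → l + p + q = l → l + p = l

namespace SortingSemiring

variable {L : Type*} [SortingSemiring L]

/-- The order of a sorting semiring†: `l ≥ k` when `l = k` or `l = k + p` for some `p ∈ L₊`. -/
def Le (k l : L) : Prop := l = k ∨ ∃ p ∈ pos (L := L), l = k + p

/-- An element `l` is infinite if it is not finite, i.e. if `l + m = l` for some `m ∈ L₊`. -/
def IsInfinite (l : L) : Prop := ∃ m ∈ pos (L := L), l + m = l

end SortingSemiring

open SortingSemiring in
/-- The `ν`-relation attached to a sorting map `s` and sort transition maps `ν`: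
`a ≅_ν b` when `a` and `b` have the same image in some layer `m ≥ s a, s b`. -/
def NuRel {L R : Type*} [SortingSemiring L] (s : R → L) (ν : L → R → R) (a b : R) : Prop :=
  ∃ m : L, Le (s a) m ∧ Le (s b) m ∧ ν m a = ν m b

open SortingSemiring in
/-- An `L`-quasi-layered domain† structure on a commutative semiring† `R`.

The layer `R_ℓ` is the fibre of the sorting map over `ℓ`, so that `R` is the disjoint union of its
layers.  For `m ≥ ℓ` the sort transition map `ν_{m,ℓ} : R_ℓ → R_m` is the restriction of
`trans m` to the layer `R_ℓ`; the values `trans m a` for which `m ≥ sort a` fails are never used. -/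
structure QuasiLayeredDomain (L R : Type*) [SortingSemiring L] [CommSemiringDagger R] where
  /-- the sorting map `s : R → L` -/
  sort : R → L
  /-- the sort transition maps, `ν_{m,ℓ} a = trans m a` for `a ∈ R_ℓ` and `m ≥ ℓ` -/
  trans : L → R → R
  sort_trans : ∀ {a : R} {m : L}, Le (sort a) m → sort (trans m a) = m
  trans_self : ∀ a : R, trans (sort a) a = a
  trans_trans : ∀ {a : R} {l m : L}, Le (sort a) l → Le l m → trans m (trans l a) = trans m a
  /-- Axiom A1. -/
  sort_one : sort 1 = 1
  /-- Axiom A2. -/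
  sort_mul : ∀ a b : R, sort (a * b) = sort a * sort b
  /-- Axiom A3: the transition maps are multiplicative,
  `ν_{m,k}(a) ν_{m',ℓ}(b) = ν_{mm',kℓ}(ab)`.  For positive `k, ℓ` one always has `mm' ≥ kℓ`. -/
  trans_mul_trans : ∀ {a b : R} {m m' : L}, Le (sort a) m → Le (sort b) m' →
    Le (sort a * sort b) (m * m') → trans m a * trans m' b = trans (m * m') (a * b)
  /-- Axiom A3 for `mm' ≤ kℓ`, which for positive `k, ℓ` says nothing new: here
  `ν_{kℓ,mm'}` maps `ν_{m,k}(a) ν_{m',ℓ}(b)` to `ab`. -/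
  trans_mul_trans' : ∀ {a b : R} {m m' : L}, Le (sort a) m → Le (sort b) m' →
    Le (m * m') (sort a * sort b) →
      trans (sort a * sort b) (trans m a * trans m' b) = a * b
  /-- Axiom A4.  For positive `sort a` one always has `l + l' ≥ sort a`. -/
  trans_add_trans : ∀ {a : R} {l l' : L}, Le (sort a) l → Le (sort a) l' →
    Le (sort a) (l + l') → trans l a + trans l' a = trans (l + l') a
  /-- Axiom B (supertropicality), the layer of a sum. -/
  sort_add : ∀ {a b : R}, NuRel sort trans a b → sort (a + b) = sort a + sort b
  /-- Axiom B (supertropicality), the `ν`-value of a sum. -/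
  add_nuRel : ∀ {a b : R}, NuRel sort trans a b → NuRel sort trans (a + b) a
  /-- Axiom B (supertropicality), infinite layers. -/
  add_eq_of_infinite : ∀ {a b : R}, NuRel sort trans a b → sort a ∈ pos (L := L) →
    IsInfinite (sort a) → a + b = a

namespace QuasiLayeredDomain

open SortingSemiring

variable {L R : Type*} [SortingSemiring L] [CommSemiringDagger R] (D : QuasiLayeredDomain L R)

/-- The layer `R_l`. -/
def layer (l : L) : Set R := {a | D.sort a = l}

/-- `ν`-equivalence `a ≅_ν b`. -/
def NuEquiv (a b : R) : Prop := NuRel D.sort D.trans a b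

/-- `a ≤_ν b` when `a + b ≅_ν b`. -/
def NuLe (a b : R) : Prop := D.NuEquiv (a + b) b

/-- `a <_ν b` when `a ≤_ν b` and not `a ≅_ν b`. -/
def NuLt (a b : R) : Prop := D.NuLe a b ∧ ¬ D.NuEquiv a b

/-- An `L`-layered domain† is a `ν`-bipotent `L`-quasi-layered domain†. -/
structure IsLayeredDomain : Prop where
  /-- `ν`-equivalence respects addition. -/
  add_congr : ∀ {a a' b b' : R}, D.NuEquiv a a' → D.NuEquiv b b' → D.NuEquiv (a + b) (a' + b')
  lt_or_lt : ∀ {a b : R}, ¬ D.NuEquiv a b → D.NuLt a b ∨ D.NuLt b a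
  add_eq_right : ∀ {a b : R}, D.NuLt a b → a + b = b

/-- `R` is uniform if `L` is totally ordered and all sort transition maps are bijective. -/
structure IsUniform : Prop where
  total : ∀ k l : L, Le k l ∨ Le l k
  bijOn : ∀ {k l : L}, Le k l → Set.BijOn (D.trans l) (D.layer k) (D.layer l)

/-- An `L`-layered `1`-semifield†: an `L`-layered domain† whose tangible layer `R_1` is a group. -/
structure IsLayeredOneSemifield : Prop extends D.IsLayeredDomain where
  exists_inv : ∀ a ∈ D.layer 1, ∃ b ∈ D.layer 1, a * b = 1

/-- `ν`-equivalence on `R ∪ {0}`: the adjoined `0` is `ν`-equivalent to itself only. -/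
inductive NuEquivZero : WithZero R → WithZero R → Prop
  | zero : NuEquivZero 0 0
  | coe {a b : R} (h : D.NuEquiv a b) : NuEquivZero (a : WithZero R) (b : WithZero R)

end QuasiLayeredDomain

/-- The Sylvester matrix of `f = ∑ αᵢ λⁱ` and `g = ∑ βⱼ λʲ`, of degrees `m` and `n`: the first `n`
rows are the shifts of `α₀ α₁ … α_m`, the last `m` rows the shifts of `β₀ β₁ … β_n`. -/
noncomputable def layeredSylvester {S : Type*} [CommSemiring S] (f g : S[X]) :
    Matrix (Fin (g.natDegree + f.natDegree)) (Fin (g.natDegree + f.natDegree)) S :=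
  (Polynomial.sylvester g f g.natDegree f.natDegree).transpose

/-- The layered resultant `|ℜ(f,g)|`: the permanent of the Sylvester matrix if `f` and `g` have
positive degrees `m` and `n`, and `α₀ⁿ`, respectively `β₀ᵐ`, if `f`, respectively `g`, is
constant. -/
noncomputable def layeredResultant {S : Type*} [CommSemiring S] (f g : S[X]) : S :=
  if f.natDegree = 0 then f.coeff 0 ^ g.natDegree
  else if g.natDegree = 0 then g.coeff 0 ^ f.natDegree
  else (layeredSylvester f g).permanent

/-! In a uniform layered `1`-semifield, `ν`-equivalence is a congruence on `R ∪ {0}`, and the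
quotient is a semifield in which addition is a maximum (`nuCon`, `MaxSemifield.ofBipotent`). The
quotient map sends only `0` to `0`, so it preserves degrees and commutes with the resultant
(`layeredResultant_map`). It remains to prove equalities over such a semifield.

There a tropical Poisson formula holds: the resultant is `lc(f) ^ deg g * ∏ g(c t)`, where the `c t`
are the corner roots of `f` (`layeredResultant_eq_prod`). It is multiplicative in `g`, and the
symmetry of the resultant gives the other identity. Corner roots need radicals; the injective
endomorphism `a ↦ a ^ (deg f)!` supplies them.

The permanent is the maximum over permutations. No permutation exceeds the product, by a
majorization argument (`prod_coeff_le`). One permutation attains it, built from the dominant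
exponents of `g` at the roots and the complementary sequence of vertices of `f`
(`exists_prod_coeff_eq`). -/

/-- A bipotent semifield: a linearly ordered semifield in which addition is the maximum. -/
class MaxSemifield (S : Type*) extends Semifield S, LinearOrder S where
  add_eq_max : ∀ a b : S, a + b = max a b

/-! ### Order and powers in a bipotent semifield -/

namespace MaxSemifield

variable {S : Type*} [MaxSemifield S]

theorem le_iff_add_eq {a b : S} : a ≤ b ↔ a + b = b := by
  rw [add_eq_max, max_eq_right_iff]

theorem zero_le (a : S) : 0 ≤ a := le_iff_add_eq.2 (zero_add a)

instance : IsOrderedMonoid S where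
  mul_le_mul_left a b hab c := by
    rw [le_iff_add_eq] at *
    rw [← add_mul, hab]

instance : IsOrderedAddMonoid S where
  add_le_add_left a b hab c := by
    simp only [add_eq_max]
    exact max_le_max hab le_rfl

theorem mul_lt_mul_right_of_ne_zero {a b c : S} (h : a < b) (hc : c ≠ 0) : a * c < b * c :=
  lt_of_le_of_ne (mul_le_mul_left h.le c) fun h' => h.ne (mul_right_cancel₀ hc h')

theorem pow_le_pow {a b : S} (h : a ≤ b) (n : ℕ) : a ^ n ≤ b ^ n := pow_le_pow_left' h n

theorem pow_lt_pow {a b : S} (h : a < b) {n : ℕ} (hn : n ≠ 0) : a ^ n < b ^ n := by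
  have hb : b ≠ 0 := ((zero_le a).trans_lt h).ne'
  obtain ⟨n, rfl⟩ := Nat.exists_eq_succ_of_ne_zero hn
  rw [pow_succ, pow_succ]
  calc a ^ n * a ≤ b ^ n * a := mul_le_mul_left (pow_le_pow h.le n) a
    _ < b ^ n * b := by
      simpa only [mul_comm] using mul_lt_mul_right_of_ne_zero h (pow_ne_zero n hb)

theorem pow_injective {n : ℕ} (hn : n ≠ 0) : Function.Injective fun a : S => a ^ n := by
  intro a b hab
  rcases lt_trichotomy a b with h | h | h
  · exact absurd hab (pow_lt_pow h hn).ne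
  · exact h
  · exact absurd hab (pow_lt_pow h hn).ne'

theorem le_of_pow_le_pow {a b : S} {n : ℕ} (hn : n ≠ 0) (h : a ^ n ≤ b ^ n) : a ≤ b :=
  le_of_not_gt fun h' => (pow_lt_pow h' hn).not_ge h

theorem sum_le {ι : Type*} {s : Finset ι} {x : ι → S} {b : S} (h : ∀ i ∈ s, x i ≤ b) :
    ∑ i ∈ s, x i ≤ b := by
  classical
  induction s using Finset.induction_on with
  | empty => simpa using zero_le b
  | insert a s ha ih =>
    rw [Finset.sum_insert ha, add_eq_max]
    exact max_le (h a (by simp)) (ih fun i hi => h i (by simp [hi]))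

theorem le_sum {ι : Type*} {s : Finset ι} (x : ι → S) {i : ι} (hi : i ∈ s) :
    x i ≤ ∑ i ∈ s, x i :=
  Finset.single_le_sum (fun j _ => zero_le (x j)) hi

/-- Raising to a positive power is an endomorphism of a bipotent semifield. -/
def powHom (n : ℕ) (hn : n ≠ 0) : S →+* S where
  toFun a := a ^ n
  map_one' := one_pow n
  map_mul' a b := mul_pow a b n
  map_zero' := zero_pow hn
  map_add' a b := by
    rcases le_total a b with h | h
    · rw [le_iff_add_eq.1 h, le_iff_add_eq.1 (pow_le_pow h n)]
    · rw [add_comm, le_iff_add_eq.1 h, add_comm, le_iff_add_eq.1 (pow_le_pow h n)]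

/-- A weighted product of an ascending sequence does not decrease when weight moves upwards. -/
theorem prod_pow_le_prod_pow_mul (c : ℕ → S) (N L : ℕ → ℕ) (m : ℕ) (x : S)
    (hmono : ∀ s t, s ≤ t → t < m → c s ≤ c t) (hx : ∀ t < m, c t ≤ x)
    (hNL : ∀ s ≤ m, ∑ t ∈ Finset.range s, L t ≤ ∑ t ∈ Finset.range s, N t) :
    ∏ t ∈ Finset.range m, c t ^ N t ≤
      (∏ t ∈ Finset.range m, c t ^ L t) *
        x ^ (∑ t ∈ Finset.range m, N t - ∑ t ∈ Finset.range m, L t) := by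
  induction m generalizing x with
  | zero => simp
  | succ m ih =>
    -- Abel summation: the surplus `d` of exponents below `m` is carried as `c m ^ d`, merged with
    -- `c m ^ N m`, and the new surplus `e` is passed on to `x`.
    have ih' := ih (c m) (fun s t h h' => hmono s t h (by omega))
      (fun t ht => hmono t m ht.le (by omega)) (fun s hs => hNL s (by omega))
    have h1 := hNL m (by omega)
    have h2 := hNL (m + 1) le_rfl
    simp only [Finset.sum_range_succ, Finset.prod_range_succ] at h2 ⊢
    obtain ⟨d, hd⟩ := Nat.exists_eq_add_of_le h1
    rw [hd] at ih' h2 ⊢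
    obtain ⟨e, he⟩ : ∃ e, d + N m = L m + e := Nat.exists_eq_add_of_le (by omega)
    rw [Nat.add_sub_cancel_left] at ih'
    rw [show ∑ t ∈ Finset.range m, L t + d + N m - (∑ t ∈ Finset.range m, L t + L m) = e by omega]
    calc (∏ t ∈ Finset.range m, c t ^ N t) * c m ^ N m
        ≤ ((∏ t ∈ Finset.range m, c t ^ L t) * c m ^ d) * c m ^ N m := mul_le_mul_left ih' _
      _ = ((∏ t ∈ Finset.range m, c t ^ L t) * c m ^ L m) * c m ^ e := by
        rw [mul_assoc, ← pow_add, he, pow_add, mul_assoc]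
      _ ≤ _ := mul_le_mul_right (pow_le_pow (hx m (by omega)) e) _

/-! ### Corner roots -/

/-- The ascending sequence `c 0, …, c (m - 1)` of the corner roots of `∑ k ≤ m, α k * X ^ k`:
the coefficients lie below those of `α m * ∏ t < m, (X + c t)`, with equality at the vertices. -/
structure IsCornerRoots (α : ℕ → S) (m : ℕ) (c : ℕ → S) : Prop where
  mono : ∀ s t, s ≤ t → t < m → c s ≤ c t
  le : ∀ k ≤ m, α k ≤ α m * ∏ t ∈ Finset.Ico k m, c t
  eq : ∀ k < m, (∀ i, i + 1 = k → c i < c k) → α k = α m * ∏ t ∈ Finset.Ico k m, c t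

/-- The Newton polygon is built from its top end: the steepest slope `d k` seen from `m` gives the
roots `k, …, m - 1`, and induction on `k` gives the rest. The bound by `x` is carried along so that
the lower roots stay below `d k`. -/
theorem exists_isCornerRoots (α : ℕ → S) (m : ℕ) (hm : α m ≠ 0)
    (hroot : ∀ k l, k < l → l ≤ m → α l ≠ 0 → ∃ d, α k = α l * d ^ (l - k)) :
    ∃ c, IsCornerRoots α m c ∧
      ∀ x, (∀ j < m, α j ≤ α m * x ^ (m - j)) → ∀ t < m, c t ≤ x := by
  induction m using Nat.strong_induction_on with
  | _ m ih =>
  rcases Nat.eq_zero_or_pos m with rfl | hpos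
  · exact ⟨0, ⟨by simp, by simp, by simp⟩, by simp⟩
  have : ∀ j, ∃ d, j < m → α j = α m * d ^ (m - j) := fun j => by
    by_cases hj : j < m
    · obtain ⟨d, hd⟩ := hroot j m hj le_rfl hm
      exact ⟨d, fun _ => hd⟩
    · exact ⟨0, fun h => absurd h hj⟩
  choose d hd using this
  obtain ⟨k, hk, hmax⟩ := Finset.exists_max_image (Finset.range m) d ⟨0, by simpa using hpos⟩
  simp only [Finset.mem_range] at hk hmax
  have hle : ∀ j < m, α j ≤ α m * d k ^ (m - j) := fun j hj => by
    rw [hd j hj]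
    exact mul_le_mul_right (pow_le_pow (hmax j hj) _) _
  have hxk : ∀ x, (∀ j < m, α j ≤ α m * x ^ (m - j)) → d k ≤ x := fun x hx => by
    have := hx k hk
    rw [hd k hk] at this
    refine le_of_pow_le_pow (n := m - k) (by omega) (le_of_not_gt fun h => this.not_gt ?_)
    simpa only [mul_comm] using mul_lt_mul_right_of_ne_zero h hm
  -- If the largest slope is `0`, all lower coefficients vanish and induction at `k` is unavailable;
  -- every root is then `0`.
  rcases eq_or_ne (d k) 0 with h0 | h0
  · have hα : ∀ j < m, α j = 0 := fun j hj => by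
      rw [hd j hj, show d j = 0 from le_antisymm (h0 ▸ hmax j hj) (zero_le _), zero_pow (by omega), mul_zero]
    refine ⟨0, ⟨by simp, fun j hj => ?_, fun j hj _ => ?_⟩, fun x _ t _ => zero_le x⟩
    · rcases hj.lt_or_eq with hj | rfl
      · rw [hα j hj]; exact zero_le _
      · simp
    · rw [hα j hj, Finset.prod_eq_zero (i := j) (by simp [hj]) rfl, mul_zero]
  have hαk : α k ≠ 0 := by
    rw [hd k hk]
    exact mul_ne_zero hm (pow_ne_zero _ h0)
  obtain ⟨c, hc, hcx⟩ := ih k hk hαk fun i l hil hl => hroot i l hil (by omega)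
  have hck : ∀ t < k, c t ≤ d k := hcx (d k) fun j hj => by
    refine (hle j (by omega)).trans_eq ?_
    rw [hd k hk, mul_assoc, ← pow_add]
    congr 2
    omega
  let e : ℕ → S := fun t => if t < k then c t else d k
  have e1 : ∀ t < k, e t = c t := fun t ht => if_pos ht
  have e2 : ∀ t, k ≤ t → e t = d k := fun t ht => if_neg (by omega)
  have p1 : ∀ j, k ≤ j → j ≤ m → ∏ t ∈ Finset.Ico j m, e t = d k ^ (m - j) := fun j hj _ => by
    rw [Finset.prod_congr rfl fun t ht => e2 t (hj.trans (Finset.mem_Ico.1 ht).1)]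
    simp
  have p2 : ∀ j ≤ k, α m * ∏ t ∈ Finset.Ico j m, e t = α k * ∏ t ∈ Finset.Ico j k, c t :=
      fun j hj => by
    rw [← Finset.prod_Ico_consecutive e hj hk.le, p1 k le_rfl hk.le, hd k hk,
      Finset.prod_congr rfl fun t ht => e1 t (Finset.mem_Ico.1 ht).2]
    ring
  refine ⟨e, ⟨fun s t hst ht => ?_, fun j hj => ?_, fun j hj hv => ?_⟩, fun x hx t ht => ?_⟩
  · by_cases htk : t < k
    · rw [e1 t htk, e1 s (by omega)]
      exact hc.mono s t hst htk
    · rw [e2 t (by omega)]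
      by_cases hsk : s < k
      · rw [e1 s hsk]; exact hck s hsk
      · rw [e2 s (by omega)]
  · rcases le_total j k with h | h
    · rw [p2 j h]; exact hc.le j h
    · rw [p1 j h hj]
      rcases hj.lt_or_eq with hj | rfl
      · exact hle j hj
      · simp
  · rcases lt_trichotomy j k with h | rfl | h
    · rw [p2 j h.le]
      refine hc.eq j h fun i hi => ?_
      have := hv i hi
      rwa [e1 j h, e1 i (by omega)] at this
    · rw [p1 j le_rfl hj.le, ← hd j hj]
    -- An index strictly inside the top edge is no vertex: the roots on both sides equal `d k`.
    · have := hv (j - 1) (by omega)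
      rw [e2 j h.le, e2 (j - 1) (by omega)] at this
      exact absurd this (lt_irrefl _)
  · by_cases htk : t < k
    · rw [e1 t htk]
      exact (hck t htk).trans (hxk x hx)
    · rw [e2 t (by omega)]; exact hxk x hx

end MaxSemifield

/-! ### Counting rows and columns -/

theorem Finset.sum_range_card_le_sum (s : Finset ℕ) :
    ∑ i ∈ Finset.range s.card, i ≤ ∑ i ∈ s, i := by
  induction s using Finset.induction_on_max with
  | empty => simp
  | insert a s hs ih =>
    have ha : a ∉ s := fun h => lt_irrefl a (hs a h)
    have hcard : s.card ≤ a := by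
      simpa using Finset.card_le_card (s := s) (t := Finset.range a) fun x hx => by
        simpa using hs x hx
    rw [Finset.card_insert_of_notMem ha, Finset.sum_range_succ, Finset.sum_insert ha]
    omega

theorem Finset.card_mul_card_sub_one_le_two_mul_sum {ι : Type*} (s : Finset ι) (f : ι → ℕ)
    (hf : Set.InjOn f s) :
    (s.card : ℤ) * (s.card - 1) ≤ 2 * ∑ i ∈ s, (f i : ℤ) := by
  classical
  have h := Finset.sum_range_card_le_sum (s.image f)
  rw [Finset.card_image_of_injOn hf, Finset.sum_image hf] at h
  have h2 := Finset.sum_range_id_mul_two s.card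
  rcases Nat.eq_zero_or_pos s.card with h0 | h0
  · rw [h0]; simp; positivity
  · zify [h0] at h h2
    linarith

/-- Two families of rows occupying disjoint sets of columns, which together form an initial
segment. -/
theorem sum_sub_le_sum_card_sub {ι κ : Type*} (A : Finset ι) (B : Finset κ) (q r : ι → ℕ)
    (p u : κ → ℕ) (M : ℕ) (hr : Set.InjOn r A) (hu : Set.InjOn u B)
    (hcard : B.card + A.card = M)
    (hsum : ∑ j ∈ B, p j + ∑ i ∈ A, q i = ∑ x ∈ Finset.range M, x) :
    ∑ j ∈ B, ((p j : ℤ) - u j) ≤ ∑ i ∈ A, ((B.card : ℤ) - (q i - r i)) := by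
  have h1 := A.card_mul_card_sub_one_le_two_mul_sum r hr
  have h2 := B.card_mul_card_sub_one_le_two_mul_sum u hu
  have h3 := Finset.sum_range_id_mul_two M
  simp only [Finset.sum_sub_distrib, Finset.sum_const, nsmul_eq_mul]
  rcases Nat.eq_zero_or_pos M with h0 | h0
  · have hA : A = ∅ := Finset.card_eq_zero.1 (by omega)
    have hB : B = ∅ := Finset.card_eq_zero.1 (by omega)
    simp [hA, hB]
  · rw [← hsum] at h3
    zify [h0] at h3 hcard
    rw [← hcard] at h3
    -- With `a` and `b` the cardinalities of `A` and `B`, the columns sum to `(a+b)(a+b-1)/2` and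
    -- the rows to at least `a(a-1)/2 + b(b-1)/2`; the difference is `ab`.
    nlinarith

/-- Cutting the matrix just before the column `P s` leaves the first `s` rows of one kind and the
rows `A` of the other, which together fill an initial segment of columns, so
`sum_sub_le_sum_card_sub` applies. -/
theorem sum_sorted_sub_le {m n : ℕ} (q : Fin n → ℕ) (P u : ℕ → ℕ)
    (hq : Function.Injective q) (hP : ∀ s t, s < t → t < m → P s < P t)
    (hu : Set.InjOn u (Finset.range m)) (hdisj : ∀ i, ∀ t < m, q i ≠ P t)
    (hqlt : ∀ i, q i < n + m) (hPlt : ∀ t < m, P t < n + m)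
    (hqi : ∀ i : Fin n, i ≤ q i) (huP : ∀ t < m, u t ≤ P t) (s : ℕ) (hs : s ≤ m) :
    ∑ t ∈ Finset.range s, (P t - u t) ≤ ∑ i : Fin n, (s - (q i - i)) := by
  have hPinj : Set.InjOn P (Finset.range m) := fun a ha b hb hab => by
    simp only [Finset.coe_range, Set.mem_Iio] at ha hb
    rcases lt_trichotomy a b with h | h | h
    · exact absurd hab (hP a b h hb).ne
    · exact h
    · exact absurd hab (hP b a h ha).ne'
  have hcover : ∀ x < n + m, (∃ t < m, P t = x) ∨ ∃ i, q i = x := fun x hx => by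
    have hsub : (Finset.range m).image P ∪ Finset.univ.image q ⊆ Finset.range (n + m) := by
      intro y hy
      simp only [Finset.mem_union, Finset.mem_image, Finset.mem_range, Finset.mem_univ,
        true_and] at hy ⊢
      rcases hy with ⟨t, ht, rfl⟩ | ⟨i, rfl⟩
      · exact hPlt t ht
      · exact hqlt i
    have hdis : Disjoint ((Finset.range m).image P) (Finset.univ.image q) := by
      rw [Finset.disjoint_left]
      intro y hy hy'
      simp only [Finset.mem_image, Finset.mem_range, Finset.mem_univ, true_and] at hy hy'
      obtain ⟨t, ht, rfl⟩ := hy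
      obtain ⟨i, hi⟩ := hy'
      exact hdisj i t ht hi
    have := Finset.eq_of_subset_of_card_le hsub (by
      rw [Finset.card_union_of_disjoint hdis, Finset.card_image_of_injOn hPinj,
        Finset.card_image_of_injective _ hq]
      simp [add_comm])
    have hx' : x ∈ (Finset.range m).image P ∪ Finset.univ.image q := by
      rw [this]; simpa using hx
    simpa using hx'
  obtain ⟨M, hM, hPM⟩ : ∃ M ≤ n + m, ∀ t < m, P t < M ↔ t < s := by
    by_cases h : s < m
    · refine ⟨P s, (hPlt s h).le, fun t ht => ⟨fun h' => ?_, fun h' => hP t s h' h⟩⟩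
      by_contra hts
      rcases (not_lt.1 hts).lt_or_eq with h2 | h2
      · exact absurd (hP s t h2 ht) h'.not_gt
      · exact absurd h' (by rw [h2]; exact lt_irrefl _)
    · exact ⟨n + m, le_rfl, fun t ht => ⟨fun _ => by omega, fun _ => hPlt t ht⟩⟩
  let A : Finset (Fin n) := Finset.univ.filter fun i => q i < M
  have hPinj' : Set.InjOn P (Finset.range s) :=
    hPinj.mono (by simpa using hs)
  have hdis : Disjoint ((Finset.range s).image P) (A.image q) := by
    rw [Finset.disjoint_left]
    intro y hy hy'
    simp only [Finset.mem_image, Finset.mem_range] at hy hy'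
    obtain ⟨t, ht, rfl⟩ := hy
    obtain ⟨i, -, hi⟩ := hy'
    exact hdisj i t (by omega) hi
  have hun : (Finset.range s).image P ∪ A.image q = Finset.range M := by
    ext x
    simp only [Finset.mem_union, Finset.mem_image, Finset.mem_range, A, Finset.mem_filter,
      Finset.mem_univ, true_and]
    constructor
    · rintro (⟨t, ht, rfl⟩ | ⟨i, hi, rfl⟩)
      · exact (hPM t (by omega)).2 ht
      · exact hi
    · intro hx
      rcases hcover x (by omega) with ⟨t, ht, rfl⟩ | ⟨i, rfl⟩
      · exact Or.inl ⟨t, (hPM t ht).1 hx, rfl⟩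
      · exact Or.inr ⟨i, hx, rfl⟩
  have key := sum_sub_le_sum_card_sub A (Finset.range s) q (fun i => (i : ℕ)) P u M
    (Fin.val_injective.injOn) (hu.mono (by simpa using hs))
    (by rw [← Finset.card_range M, ← hun, Finset.card_union_of_disjoint hdis,
      Finset.card_image_of_injOn hPinj', Finset.card_image_of_injective _ hq])
    (by rw [← hun, Finset.sum_union hdis, Finset.sum_image hPinj', Finset.sum_image hq.injOn])
  have e1 : ((∑ t ∈ Finset.range s, (P t - u t) : ℕ) : ℤ) =
      ∑ t ∈ Finset.range s, ((P t : ℤ) - u t) := by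
    push_cast
    refine Finset.sum_congr rfl fun t ht => ?_
    have := huP t (by have := Finset.mem_range.1 ht; omega)
    omega
  -- Truncated subtraction only enlarges each term.
  have e2 : ∑ i ∈ A, (((Finset.range s).card : ℤ) - (q i - (i : ℕ))) ≤
      ((∑ i ∈ A, (s - (q i - i)) : ℕ) : ℤ) := by
    push_cast
    refine Finset.sum_le_sum fun i _ => ?_
    have := hqi i
    rw [Finset.card_range]
    omega
  have e3 : ∑ i ∈ A, (s - (q i - i)) ≤ ∑ i : Fin n, (s - (q i - i)) :=
    Finset.sum_le_univ_sum_of_nonneg fun _ => Nat.zero_le _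
  zify at e3 ⊢
  zify at e1 e2
  linarith

/-! ### Upper bound for the permanent -/

namespace MaxSemifield

variable {S : Type*} [MaxSemifield S]

theorem eval_le_mul {g : S[X]} {l : ℕ} (x : S) : g.coeff l * x ^ l ≤ g.eval x := by
  by_cases h : l ∈ g.support
  · rw [eval_eq_sum, Polynomial.sum]
    exact le_sum (fun i => g.coeff i * x ^ i) h
  · rw [notMem_support_iff.1 h, zero_mul]
    exact zero_le _

/-- Here `q` and `p` are the columns a permutation gives to the rows of `f` and of `g`. The
`f`-factors are bounded by powers `c t ^ N t`. Matching the `g`-rows, in order of column, with the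
ascending roots gives exponents `P t - u t` of the same total but weighted towards larger roots.
Each `c t ^ (P t - u t)` then joins its `g`-coefficient to form a term of `g(c t)`. -/
theorem prod_coeff_le {m n : ℕ} (f g : S[X]) (c : ℕ → S) (hc : IsCornerRoots f.coeff m c)
    (q : Fin n → ℕ) (p : Fin m → ℕ) (hq : Function.Injective q) (hp : Function.Injective p)
    (hqp : ∀ i j, q i ≠ p j) (hq1 : ∀ i : Fin n, i ≤ q i) (hq2 : ∀ i : Fin n, q i ≤ i + m)
    (hp1 : ∀ j : Fin m, j ≤ p j) (hp2 : ∀ j : Fin m, p j ≤ j + n) :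
    (∏ i : Fin n, f.coeff (q i - i)) * ∏ j : Fin m, g.coeff (p j - j) ≤
      f.coeff m ^ n * ∏ t ∈ Finset.range m, g.eval (c t) := by
  have hqlt : ∀ i, q i < n + m := fun i => by have := hq2 i; omega
  have hplt : ∀ j, p j < n + m := fun j => by have := hp2 j; omega
  let π := Tuple.sort p
  have hπ : StrictMono (p ∘ π) :=
    (Tuple.monotone_sort p).strictMono_of_injective (hp.comp π.injective)
  let P : ℕ → ℕ := fun t => if h : t < m then p (π ⟨t, h⟩) else 0
  let u : ℕ → ℕ := fun t => if h : t < m then π ⟨t, h⟩ else 0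
  have hPe : ∀ t : Fin m, P t = p (π t) := fun t => by simp [P]
  have hue : ∀ t : Fin m, u t = π t := fun t => by simp [u]
  let N : ℕ → ℕ := fun t => (Finset.univ.filter fun i : Fin n => q i - i ≤ t).card
  have hN : ∀ s, ∑ t ∈ Finset.range s, N t = ∑ i : Fin n, (s - (q i - i)) := fun s => by
    simp only [N, Finset.card_filter]
    rw [Finset.sum_comm]
    refine Finset.sum_congr rfl fun i _ => ?_
    rw [← Finset.card_filter, ← Nat.card_Ico (q i - i) s]
    congr 1
    ext t
    simp [and_comm]
  have hmaj : ∀ s ≤ m, ∑ t ∈ Finset.range s, (P t - u t) ≤ ∑ t ∈ Finset.range s, N t := by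
    intro s hs
    rw [hN]
    refine sum_sorted_sub_le q P u hq (fun s t hst ht => ?_) (fun a ha b hb hab => ?_)
      (fun i t ht => ?_) hqlt (fun t ht => ?_) hq1 (fun t ht => ?_) s hs
    · rw [hPe ⟨t, ht⟩, hPe ⟨s, hst.trans ht⟩]
      exact hπ hst
    · simp only [Finset.coe_range, Set.mem_Iio] at ha hb
      rw [hue ⟨a, ha⟩, hue ⟨b, hb⟩] at hab
      exact congrArg Fin.val (π.injective (Fin.ext hab))
    · rw [hPe ⟨t, ht⟩]; exact hqp _ _
    · rw [hPe ⟨t, ht⟩]; exact hplt _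
    · rw [hPe ⟨t, ht⟩, hue ⟨t, ht⟩]; exact hp1 _
  -- Comparing the sum of all columns with that of all rows: the shifts `q i - i` and `p j - j` add
  -- up to `n * m`.
  have htot : ∑ t ∈ Finset.range m, N t = ∑ t ∈ Finset.range m, (P t - u t) := by
    have e1 : ∑ t ∈ Finset.range m, (P t - u t) = ∑ j : Fin m, (p j - j) := by
      rw [← Fin.sum_univ_eq_sum_range (fun t => P t - u t)]
      simp only [hPe, hue]
      exact Equiv.sum_comp π fun j => p j - (j : ℕ)
    rw [hN, e1]
    have hinj : Function.Injective (Fin.addCases q p : Fin (n + m) → ℕ) := by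
      intro a b
      induction a using Fin.addCases <;> induction b using Fin.addCases <;>
        simp only [Fin.addCases_left, Fin.addCases_right]
      · exact fun h => congrArg _ (hq h)
      · exact fun h => absurd h (hqp _ _)
      · exact fun h => absurd h.symm (hqp _ _)
      · exact fun h => congrArg _ (hp h)
    have himg : Finset.univ.image (Fin.addCases q p : Fin (n + m) → ℕ) =
        Finset.range (n + m) := by
      refine Finset.eq_of_subset_of_card_le (fun x hx => ?_) ?_
      · simp only [Finset.mem_image, Finset.mem_univ, true_and] at hx
        obtain ⟨a, rfl⟩ := hx
        induction a using Fin.addCases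
        · simpa using hqlt _
        · simpa using hplt _
      · rw [Finset.card_image_of_injective _ hinj]; simp
    have hs1 : ∑ i, q i + ∑ j, p j = ∑ x ∈ Finset.range (n + m), x := by
      rw [← himg, Finset.sum_image hinj.injOn, Fin.sum_univ_add]
      simp
    have hs2 : ∑ i : Fin n, (i : ℕ) + ∑ j : Fin m, (n + (j : ℕ)) =
        ∑ x ∈ Finset.range (n + m), x := by
      rw [← Fin.sum_univ_eq_sum_range (fun x => x), Fin.sum_univ_add]
      simp
    have e2 : ∑ i : Fin n, (m - (q i - i)) + ∑ i, q i = n * m + ∑ i : Fin n, (i : ℕ) := by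
      rw [← Finset.sum_add_distrib, Finset.sum_congr rfl
        (g := fun i : Fin n => m + (i : ℕ)) fun i _ => by
          have := hq1 i; have := hq2 i; omega]
      simp [Finset.sum_add_distrib]
    have e3 : ∑ j : Fin m, (p j - j) + ∑ j : Fin m, (j : ℕ) = ∑ j, p j := by
      rw [← Finset.sum_add_distrib]
      exact Finset.sum_congr rfl fun j _ => by have := hp1 j; omega
    simp only [Finset.sum_add_distrib, Finset.sum_const, Finset.card_univ, Fintype.card_fin,
      smul_eq_mul] at hs2
    rw [mul_comm m n] at hs2
    omega
  have hf : ∏ i : Fin n, f.coeff (q i - i) ≤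
      f.coeff m ^ n * ∏ t ∈ Finset.range m, c t ^ N t := by
    calc ∏ i : Fin n, f.coeff (q i - i)
        ≤ ∏ i : Fin n, (f.coeff m * ∏ t ∈ Finset.range m, if q i - i ≤ t then c t else 1) := by
          refine Finset.prod_le_prod' fun i _ => (hc.le _ ?_).trans_eq ?_
          · have := hq2 i; omega
          · rw [← Finset.prod_filter]
            congr 2
            ext t
            simp [and_comm]
      _ = _ := by
          rw [Finset.prod_mul_distrib, Finset.prod_comm]
          congr 1
          · simp
          · refine Finset.prod_congr rfl fun t _ => ?_
            rw [← Finset.prod_filter, Finset.prod_const]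
  have hprod : ∏ t ∈ Finset.range m, c t ^ N t ≤ ∏ t ∈ Finset.range m, c t ^ (P t - u t) := by
    rcases Nat.eq_zero_or_pos m with rfl | hm
    · simp
    · have := prod_pow_le_prod_pow_mul c N (fun t => P t - u t) m (c (m - 1)) hc.mono
        (fun t ht => hc.mono t (m - 1) (by omega) (by omega)) hmaj
      rwa [htot, Nat.sub_self, pow_zero, mul_one] at this
  have hg : ∏ j : Fin m, g.coeff (p j - j) = ∏ t ∈ Finset.range m, g.coeff (P t - u t) := by
    rw [← Fin.prod_univ_eq_prod_range (fun t => g.coeff (P t - u t))]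
    simp only [hPe, hue]
    exact (Equiv.prod_comp π fun j => g.coeff (p j - (j : ℕ))).symm
  calc _ ≤ (f.coeff m ^ n * ∏ t ∈ Finset.range m, c t ^ (P t - u t)) *
        ∏ t ∈ Finset.range m, g.coeff (P t - u t) := by
        rw [hg]
        exact mul_le_mul_left (hf.trans (mul_le_mul_right hprod _)) _
    _ = f.coeff m ^ n * ∏ t ∈ Finset.range m, (g.coeff (P t - u t) * c t ^ (P t - u t)) := by
        rw [Finset.prod_mul_distrib]; ring
    _ ≤ _ := mul_le_mul_right (Finset.prod_le_prod' fun t _ => eval_le_mul _) _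

end MaxSemifield

/-! ### A permutation attaining the bound, and the product formula -/

namespace MaxSemifield

variable {S : Type*} [MaxSemifield S]

theorem exists_eval_eq (g : S[X]) (x : S) :
    ∃ l ≤ g.natDegree, g.coeff l * x ^ l = g.eval x ∧
      ∀ j < l, g.coeff j * x ^ j < g.eval x := by
  classical
  have hex : ∃ l, l ≤ g.natDegree ∧ g.eval x ≤ g.coeff l * x ^ l := by
    obtain ⟨l, hl, hmax⟩ := Finset.exists_max_image (Finset.range (g.natDegree + 1))
      (fun l => g.coeff l * x ^ l) ⟨0, by simp⟩
    refine ⟨l, by simpa [Nat.lt_succ_iff] using hl, ?_⟩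
    rw [eval_eq_sum_range]
    exact sum_le hmax
  refine ⟨Nat.find hex, (Nat.find_spec hex).1,
    le_antisymm (eval_le_mul x) (Nat.find_spec hex).2, fun j hj => ?_⟩
  have h := Nat.find_min hex hj
  have h' := (Nat.find_spec hex).1
  by_contra hlt
  exact h ⟨by omega, not_lt.1 hlt⟩

/-- The least exponent of a dominant term grows with the argument. -/
theorem exists_monotone_eval_eq (g : S[X]) :
    ∃ l : S → ℕ, Monotone l ∧ (∀ x, l x ≤ g.natDegree) ∧
      ∀ x, g.coeff (l x) * x ^ l x = g.eval x := by
  choose l hl he hlt using exists_eval_eq g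
  refine ⟨l, fun x y hxy => ?_, hl, he⟩
  by_contra! h
  have hy : y ≠ 0 := by
    rintro rfl
    have hx : x = 0 := le_antisymm hxy (zero_le x)
    rw [hx] at h
    exact lt_irrefl _ h
  -- At `x` the term of exponent `l x` strictly beats that of `l y`. Cancelling the common power and
  -- enlarging `x` to `y` keeps this true at `y`, against the dominance of `l y`.
  have h1 := hlt x (l y) h
  rw [← he x, ← Nat.sub_add_cancel h.le, pow_add, ← mul_assoc, Nat.sub_add_cancel h.le] at h1
  have h2 : g.coeff (l y) < g.coeff (l x) * x ^ (l x - l y) :=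
    lt_of_not_ge fun h' => h1.not_ge (mul_le_mul_left h' _)
  have h3 := mul_lt_mul_right_of_ne_zero
    (h2.trans_le (mul_le_mul_right (pow_le_pow hxy _) _)) (pow_ne_zero (l y) hy)
  rw [he y, mul_assoc, ← pow_add, Nat.sub_add_cancel h.le] at h3
  exact h3.not_ge (eval_le_mul y)

/-- `l j` is the least dominant exponent of `g` at `c j`, and `k i` is the first index whose root
has dominant exponent above `i`, or `m`. Then `c t` occurs in the `f`-factors exactly `l t` times,
completing the term of `g(c t)`. -/
theorem exists_prod_coeff_eq {m : ℕ} (f g : S[X]) (c : ℕ → S)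
    (hc : IsCornerRoots f.coeff m c) :
    ∃ (k : Fin g.natDegree → ℕ) (l : Fin m → ℕ), Monotone k ∧ Monotone l ∧ (∀ i, k i ≤ m) ∧
      (∀ j, l j ≤ g.natDegree) ∧ (∀ (i : Fin g.natDegree) (j : Fin m), (j : ℕ) < k i ↔ l j ≤ i) ∧
      (∏ i, f.coeff (k i)) * ∏ j, g.coeff (l j) =
        f.coeff m ^ g.natDegree * ∏ t ∈ Finset.range m, g.eval (c t) := by
  classical
  obtain ⟨l, hl, hln, he⟩ := exists_monotone_eval_eq g
  have hlc : ∀ s t, s ≤ t → t < m → l (c s) ≤ l (c t) := fun s t h h' => hl (hc.mono s t h h')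
  have hex : ∀ i : ℕ, ∃ k, k = m ∨ i < l (c k) := fun i => ⟨m, Or.inl rfl⟩
  let k : ℕ → ℕ := fun i => Nat.find (hex i)
  have hkm : ∀ i, k i ≤ m := fun i => Nat.find_min' (hex i) (Or.inl rfl)
  have hk : ∀ i, ∀ j < m, j < k i ↔ l (c j) ≤ i := fun i j hj => by
    constructor
    · intro h
      have := Nat.find_min (hex i) h
      omega
    · intro h
      by_contra! hle
      rcases Nat.find_spec (hex i) with h' | h'
      · exact absurd (h' ▸ hle : m ≤ j) (by omega)
      · have := hlc (k i) j hle hj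
        exact absurd (h'.trans_le this) (by omega)
  have hf : ∀ i, f.coeff (k i) = f.coeff m * ∏ t ∈ Finset.Ico (k i) m, c t := fun i => by
    rcases (hkm i).lt_or_eq with h | h
    -- `k i` is a vertex: the dominant exponent jumps past `i` there, so the root must jump too.
    · refine hc.eq _ h fun j hj => lt_of_le_of_ne (hc.mono _ _ (by omega) h) fun hcj => ?_
      have h1 := (hk i j (by omega)).1 (by omega)
      have h2 := (hk i (k i) h).not.1 (lt_irrefl _)
      rw [hcj] at h1
      exact h2 h1
    · rw [h]; simp
  refine ⟨fun i => k i, fun j => l (c j), fun a b hab => ?_, fun a b hab => hlc a b hab b.2,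
    fun i => hkm i, fun j => hln _, fun i j => hk i j j.2, ?_⟩
  · refine Nat.find_min' (hex a) ?_
    rcases Nat.find_spec (hex b) with h | h
    · exact Or.inl h
    · exact Or.inr (lt_of_le_of_lt hab h)
  · rw [Fin.prod_univ_eq_prod_range (fun i => f.coeff (k i)),
      Fin.prod_univ_eq_prod_range (fun j => g.coeff (l (c j))),
      Finset.prod_congr rfl fun i _ => hf i, Finset.prod_mul_distrib, Finset.prod_const,
      Finset.card_range, mul_assoc]
    congr 1
    have : ∀ i, ∏ t ∈ Finset.Ico (k i) m, c t =
        ∏ t ∈ Finset.range m, if i < l (c t) then c t else 1 := fun i => by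
      rw [← Finset.prod_filter]
      refine Finset.prod_congr ?_ fun _ _ => rfl
      ext t
      have := hk i t
      simp only [Finset.mem_Ico, Finset.mem_filter, Finset.mem_range]
      constructor
      · rintro ⟨h1, h2⟩
        have := this h2
        exact ⟨h2, by omega⟩
      · rintro ⟨h1, h2⟩
        have := this h1
        exact ⟨by omega, h1⟩
    simp only [this]
    rw [Finset.prod_comm, ← Finset.prod_mul_distrib]
    refine Finset.prod_congr rfl fun t _ => ?_
    rw [← Finset.prod_filter, Finset.prod_const, ← he, mul_comm]
    congr 2
    refine Eq.trans (congrArg Finset.card ?_) (Finset.card_range (l (c t)))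
    ext i
    have := hln (c t)
    simp only [Finset.mem_filter, Finset.mem_range]
    omega

theorem permanent_sylvester_le {m n : ℕ} (f g : S[X]) (c : ℕ → S)
    (hc : IsCornerRoots f.coeff m c) :
    (sylvester g f n m).permanent ≤ f.coeff m ^ n * ∏ t ∈ Finset.range m, g.eval (c t) := by
  refine sum_le fun σ _ => ?_
  by_cases hσ : ∀ i, sylvester g f n m (σ i) i ≠ 0
  · have h1 : ∀ i : Fin n, (σ (Fin.castAdd m i) : ℕ) ∈ Set.Icc (i : ℕ) (i + m) := fun i => by
      by_contra h
      exact hσ (Fin.castAdd m i) (by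
        simp only [sylvester, Matrix.of_apply, Fin.addCases_left, if_neg h])
    have h2 : ∀ j : Fin m, (σ (Fin.natAdd n j) : ℕ) ∈ Set.Icc (j : ℕ) (j + n) := fun j => by
      by_contra h
      exact hσ (Fin.natAdd n j) (by
        simp only [sylvester, Matrix.of_apply, Fin.addCases_right, if_neg h])
    rw [Fin.prod_univ_add]
    simp only [sylvester, Matrix.of_apply, Fin.addCases_left, Fin.addCases_right, if_pos (h1 _),
      if_pos (h2 _)]
    refine prod_coeff_le f g c hc (fun i => σ (Fin.castAdd m i)) (fun j => σ (Fin.natAdd n j))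
      (fun a b h => ?_) (fun a b h => ?_) (fun i j h => ?_) (fun i => (h1 i).1)
      (fun i => (h1 i).2) (fun j => (h2 j).1) (fun j => (h2 j).2)
    · exact Fin.castAdd_injective n m (σ.injective (Fin.ext h))
    · exact Fin.natAdd_injective m n (σ.injective (Fin.ext h))
    · have := congrArg Fin.val (σ.injective (Fin.ext h))
      simp only [Fin.val_castAdd, Fin.val_natAdd] at this
      omega
  · push Not at hσ
    obtain ⟨i, hi⟩ := hσ
    exact (Finset.prod_eq_zero (f := fun i => sylvester g f n m (σ i) i) (Finset.mem_univ i)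
      hi).trans_le (zero_le _)

/-- The columns `i + k i` and `j + l j` form a permutation: each family increases strictly by
monotonicity, and `j < k i ↔ l j ≤ i` keeps the two apart. -/
theorem le_permanent_sylvester {m : ℕ} (f g : S[X]) (c : ℕ → S)
    (hc : IsCornerRoots f.coeff m c) :
    f.coeff m ^ g.natDegree * ∏ t ∈ Finset.range m, g.eval (c t) ≤
      (sylvester g f g.natDegree m).permanent := by
  obtain ⟨k, l, hk, hl, hkm, hln, hkl, he⟩ := exists_prod_coeff_eq f g c hc
  let τ : Fin (g.natDegree + m) → Fin (g.natDegree + m) :=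
    Fin.addCases (fun i => ⟨i + k i, by have := hkm i; omega⟩)
      (fun j => ⟨j + l j, by have := hln j; omega⟩)
  have τ1 : ∀ i, (τ (Fin.castAdd m i) : ℕ) = i + k i := fun i => by simp [τ]
  have τ2 : ∀ j, (τ (Fin.natAdd g.natDegree j) : ℕ) = j + l j := fun j => by simp [τ]
  have hsep : ∀ (i : Fin g.natDegree) (j : Fin m), (i : ℕ) + k i ≠ j + l j := fun i j => by have := hkl i j; omega
  have hτ : Function.Injective τ := by
    intro a b hab
    replace hab := congrArg Fin.val hab
    induction a using Fin.addCases with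
    | left a =>
      induction b using Fin.addCases with
      | left b =>
        rw [τ1, τ1] at hab
        congr 1
        rcases le_total a b with h | h
        · have := hk h
          ext; omega
        · have := hk h
          ext; omega
      | right b =>
        rw [τ1, τ2] at hab
        exact absurd hab (hsep _ _)
    | right a =>
      induction b using Fin.addCases with
      | left b =>
        rw [τ1, τ2] at hab
        exact absurd hab.symm (hsep _ _)
      | right b =>
        rw [τ2, τ2] at hab
        congr 1
        rcases le_total a b with h | h
        · have := hl h
          ext; omega
        · have := hl h
          ext; omega
  let σ : Equiv.Perm (Fin (g.natDegree + m)) :=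
    Equiv.ofBijective τ (Finite.injective_iff_bijective.1 hτ)
  have hσ : ∀ i, σ i = τ i := fun _ => rfl
  refine le_trans (le_of_eq ?_) (le_sum (fun σ : Equiv.Perm (Fin (g.natDegree + m)) =>
    ∏ i, sylvester g f g.natDegree m (σ i) i) (Finset.mem_univ σ))
  rw [← he, Fin.prod_univ_add]
  simp only [sylvester, Matrix.of_apply, Fin.addCases_left, Fin.addCases_right, hσ, τ1, τ2]
  congr 1
  · refine Finset.prod_congr rfl fun i _ => ?_
    rw [if_pos ⟨by omega, by have := hkm i; omega⟩, Nat.add_sub_cancel_left]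
  · refine Finset.prod_congr rfl fun j _ => ?_
    rw [if_pos ⟨by omega, by have := hln j; omega⟩, Nat.add_sub_cancel_left]

theorem layeredResultant_eq_prod (f g : S[X]) (c : ℕ → S)
    (hc : IsCornerRoots f.coeff f.natDegree c) :
    layeredResultant f g =
      f.leadingCoeff ^ g.natDegree * ∏ t ∈ Finset.range f.natDegree, g.eval (c t) := by
  unfold layeredResultant
  split_ifs with h1 h2
  · simp [leadingCoeff, h1]
  · rw [eq_C_of_natDegree_eq_zero h2]
    simp
  · rw [layeredSylvester, Matrix.permanent_transpose]
    exact le_antisymm (permanent_sylvester_le f g c hc) (le_permanent_sylvester f g c hc)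

end MaxSemifield

/-! ### Symmetry and change of coefficients for the resultant -/

theorem Matrix.permanent_reindex {ι κ A : Type*} [Fintype ι] [DecidableEq ι] [Fintype κ]
    [DecidableEq κ] [CommSemiring A] (e e' : ι ≃ κ) (M : Matrix ι ι A) :
    (M.reindex e e').permanent = M.permanent := by
  unfold Matrix.permanent
  refine Fintype.sum_equiv ((Equiv.equivCongr e'.symm e.symm : _ ≃ (ι ≃ ι))) _ _ fun σ => ?_
  exact Fintype.prod_equiv e'.symm _ _ fun i => by simp

theorem layeredResultant_comm {A : Type*} [CommSemiring A] (f g : A[X]) :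
    layeredResultant f g = layeredResultant g f := by
  unfold layeredResultant
  by_cases hf : f.natDegree = 0 <;> by_cases hg : g.natDegree = 0
  · simp [hf, hg]
  · simp [hf, hg]
  · simp [hf, hg]
  · simp only [hf, hg, if_false, layeredSylvester, Matrix.permanent_transpose]
    rw [sylvester_comm g f, Matrix.permanent_reindex]

theorem layeredResultant_map {A B : Type*} [CommSemiring A] [CommSemiring B] (φ : A →+* B)
    (hφ : ∀ a, φ a = 0 → a = 0) (f g : A[X]) :
    layeredResultant (f.map φ) (g.map φ) = φ (layeredResultant f g) := by
  have hdeg : ∀ p : A[X], (p.map φ).natDegree = p.natDegree := fun p => by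
    rcases eq_or_ne p 0 with rfl | hp
    · simp
    · exact natDegree_map_of_leadingCoeff_ne_zero φ fun h =>
        hp (leadingCoeff_eq_zero.1 (hφ _ h))
  unfold layeredResultant layeredSylvester
  rw [hdeg, hdeg]
  simp only [Matrix.permanent_transpose, sylvester_map_map, coeff_map, apply_ite φ, map_pow]
  congr 2
  simp [Matrix.permanent]

/-! ### Multiplicativity over a bipotent semifield -/

namespace MaxSemifield

variable {S : Type*} [MaxSemifield S]

/-- Once `l - k` divides `N`, the `N`-th power of a ratio of coefficients is an `(l - k)`-th power,
as the construction of corner roots requires. -/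
theorem exists_isCornerRoots_map_powHom (f : S[X]) {N : ℕ} (hN : N ≠ 0)
    (hdvd : ∀ k, 0 < k → k ≤ f.natDegree → k ∣ N) (hf : f ≠ 0) :
    ∃ c, IsCornerRoots (f.map (powHom N hN)).coeff f.natDegree c := by
  have hco : ∀ k, (f.map (powHom N hN)).coeff k = f.coeff k ^ N := fun k => coeff_map _ _
  obtain ⟨c, hc, -⟩ := exists_isCornerRoots (f.map (powHom N hN)).coeff f.natDegree
    (by rw [hco]; exact pow_ne_zero N (leadingCoeff_ne_zero.2 hf)) fun k l hkl hl h0 => by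
      obtain ⟨e, he⟩ := hdvd (l - k) (by omega) (by omega)
      rw [hco] at h0
      have h0' : f.coeff l ≠ 0 := fun h => h0 (by rw [h, zero_pow hN])
      refine ⟨(f.coeff k / f.coeff l) ^ e, ?_⟩
      rw [hco, hco, ← pow_mul, mul_comm e, ← he, div_pow, mul_div_cancel₀ _ h0]
  exact ⟨c, hc⟩

theorem layeredResultant_mul_right (f g h : S[X]) (hf : f ≠ 0) (hg : g ≠ 0) (hh : h ≠ 0) :
    layeredResultant f (g * h) = layeredResultant f g * layeredResultant f h := by
  have hN := f.natDegree.factorial_ne_zero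
  have hinj : Function.Injective (powHom (S := S) _ hN) := pow_injective hN
  obtain ⟨c, hc⟩ := exists_isCornerRoots_map_powHom f hN
    (fun k h1 h2 => Nat.dvd_factorial h1 h2) hf
  have hker : ∀ a, powHom (S := S) _ hN a = 0 → a = 0 := fun a ha => pow_eq_zero_iff hN |>.1 ha
  have hc' : IsCornerRoots (f.map (powHom _ hN)).coeff (f.map (powHom _ hN)).natDegree c := by
    rwa [natDegree_map_eq_of_injective hinj]
  apply hinj
  rw [map_mul, ← layeredResultant_map _ hker, ← layeredResultant_map _ hker,
    ← layeredResultant_map _ hker, layeredResultant_eq_prod _ _ c hc',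
    layeredResultant_eq_prod _ _ c hc', layeredResultant_eq_prod _ _ c hc', Polynomial.map_mul,
    natDegree_mul (by rwa [Polynomial.map_ne_zero_iff hinj])
      (by rwa [Polynomial.map_ne_zero_iff hinj]), pow_add]
  simp only [eval_mul, Finset.prod_mul_distrib]
  ring

theorem layeredResultant_mul_left (f g h : S[X]) (hf : f ≠ 0) (hg : g ≠ 0) (hh : h ≠ 0) :
    layeredResultant (f * g) h = layeredResultant f h * layeredResultant g h := by
  rw [layeredResultant_comm, layeredResultant_mul_right h f g hh hf hg,
    layeredResultant_comm h, layeredResultant_comm h]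

end MaxSemifield

/-! ### The congruence of `ν`-equivalence -/

namespace SortingSemiring

variable {L : Type*} [SortingSemiring L]

theorem Le.refl (l : L) : Le l l := Or.inl rfl

theorem Le.trans {k l m : L} (h : Le k l) (h' : Le l m) : Le k m := by
  rcases h with rfl | ⟨p, hp, rfl⟩
  · exact h'
  · rcases h' with rfl | ⟨q, hq, rfl⟩
    · exact Or.inr ⟨p, hp, rfl⟩
    · exact Or.inr ⟨p + q, add_mem_pos hp hq, add_assoc k p q⟩

end SortingSemiring

namespace QuasiLayeredDomain

open SortingSemiring

variable {L R : Type*} [SortingSemiring L] [CommSemiringDagger R] {D : QuasiLayeredDomain L R}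

theorem NuEquiv.refl (a : R) : D.NuEquiv a a := ⟨D.sort a, Le.refl _, Le.refl _, rfl⟩

theorem NuEquiv.symm {a b : R} (h : D.NuEquiv a b) : D.NuEquiv b a := by
  obtain ⟨m, ha, hb, h⟩ := h
  exact ⟨m, hb, ha, h.symm⟩

/-- Since `L` is totally ordered, both coincidences can be pushed to the higher of their two layers.
-/
theorem NuEquiv.trans (hU : D.IsUniform) {a b c : R} (h : D.NuEquiv a b) (h' : D.NuEquiv b c) :
    D.NuEquiv a c := by
  obtain ⟨m, ha, hb, hab⟩ := h
  obtain ⟨n, hb', hc, hbc⟩ := h'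
  rcases hU.total m n with hmn | hmn
  · refine ⟨n, ha.trans hmn, hc, ?_⟩
    rw [← hbc, ← D.trans_trans ha hmn, hab, D.trans_trans hb hmn]
  · refine ⟨m, ha, hc.trans hmn, ?_⟩
    rw [hab, ← D.trans_trans hc hmn, ← hbc, D.trans_trans hb' hmn]

theorem nuEquiv_trans {a : R} {m : L} (h : Le (D.sort a) m) : D.NuEquiv a (D.trans m a) := by
  refine ⟨m, h, Or.inl (D.sort_trans h).symm, ?_⟩
  have := D.trans_self (D.trans m a)
  rw [D.sort_trans h] at this
  exact this.symm

/-- The two halves of axiom A3 cover the two possible orders of the product layers. -/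
theorem nuEquiv_mul_trans (hU : D.IsUniform) {a b : R} {m n : L} (ha : Le (D.sort a) m)
    (hb : Le (D.sort b) n) : D.NuEquiv (a * b) (D.trans m a * D.trans n b) := by
  rcases hU.total (D.sort a * D.sort b) (m * n) with h | h
  · rw [D.trans_mul_trans ha hb h]
    exact nuEquiv_trans (by rwa [D.sort_mul])
  · have hs : D.sort (D.trans m a * D.trans n b) = m * n := by
      rw [D.sort_mul, D.sort_trans ha, D.sort_trans hb]
    have := nuEquiv_trans (D := D) (a := D.trans m a * D.trans n b)
      (m := D.sort a * D.sort b) (by rwa [hs])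
    rw [D.trans_mul_trans' ha hb h] at this
    exact this.symm

theorem NuEquiv.mul (hU : D.IsUniform) {a a' b b' : R} (h : D.NuEquiv a a')
    (h' : D.NuEquiv b b') : D.NuEquiv (a * b) (a' * b') := by
  obtain ⟨m, ha, ha', h⟩ := h
  obtain ⟨n, hb, hb', h'⟩ := h'
  have h1 := nuEquiv_mul_trans hU ha hb
  rw [h, h'] at h1
  exact h1.trans hU (nuEquiv_mul_trans hU ha' hb').symm

theorem exists_nuEquiv_mem_layer_one (hU : D.IsUniform) (a : R) :
    ∃ b ∈ D.layer 1, D.NuEquiv a b := by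
  rcases hU.total 1 (D.sort a) with h | h
  · obtain ⟨b, hb, hba⟩ := (hU.bijOn h).surjOn (show a ∈ D.layer (D.sort a) from rfl)
    have := nuEquiv_trans (D := D) (a := b) (m := D.sort a)
      (by rwa [show D.sort b = 1 from hb])
    rw [hba] at this
    exact ⟨b, hb, this.symm⟩
  · exact ⟨D.trans 1 a, D.sort_trans h, nuEquiv_trans h⟩

/-- Only the layer `R_1` is a group, so `a` is first replaced by a `ν`-equivalent element of it. -/
theorem exists_mul_nuEquiv_one (hD : D.IsLayeredOneSemifield) (hU : D.IsUniform) (a : R) :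
    ∃ b, D.NuEquiv (a * b) 1 := by
  obtain ⟨a', ha', h⟩ := exists_nuEquiv_mem_layer_one hU a
  obtain ⟨b, -, hb⟩ := hD.exists_inv a' ha'
  refine ⟨b, ?_⟩
  rw [← hb]
  exact h.mul hU (NuEquiv.refl b)

theorem add_nuEquiv_or (hD : D.IsLayeredDomain) (a b : R) :
    D.NuEquiv (a + b) a ∨ D.NuEquiv (a + b) b := by
  by_cases h : D.NuEquiv a b
  · exact Or.inl (D.add_nuRel h)
  · rcases hD.lt_or_lt h with h | h
    · exact Or.inr h.1
    · rw [add_comm]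
      exact Or.inl h.1

/-- `ν`-equivalence as a congruence on `R ∪ {0}`. -/
def nuCon (hD : D.IsLayeredDomain) (hU : D.IsUniform) : RingCon (WithZero R) where
  r := D.NuEquivZero
  iseqv :=
    { refl := fun a => by
        induction a using WithZero.recZeroCoe with
        | zero => exact .zero
        | coe a => exact .coe (NuEquiv.refl a)
      symm := fun h => by
        cases h with
        | zero => exact .zero
        | coe h => exact .coe h.symm
      trans := fun h h' => by
        cases h with
        | zero => exact h'
        | coe h =>
          cases h' with
          | coe h' => exact .coe (h.trans hU h') }
  mul' h h' := by
    cases h with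
    | zero => simpa only [zero_mul] using .zero
    | coe h =>
      cases h' with
      | zero => simpa only [mul_zero] using .zero
      | coe h' =>
        rw [← WithZero.coe_mul, ← WithZero.coe_mul]
        exact .coe (h.mul hU h')
  add' h h' := by
    cases h with
    | zero => simpa only [zero_add] using h'
    | coe h =>
      cases h' with
      | zero => simpa only [add_zero] using .coe h
      | coe h' =>
        rw [← WithZero.coe_add, ← WithZero.coe_add]
        exact .coe (hD.add_congr h h')

end QuasiLayeredDomain

/-- A semifield in which every sum equals one of the summands is linearly ordered by
`a ≤ b ↔ a + b = b`. -/
@[reducible] noncomputable def MaxSemifield.ofBipotent {S : Type*} [CommSemiring S]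
    (hadd : ∀ a b : S, a + b = a ∨ a + b = b) (h01 : (0 : S) ≠ 1)
    (hinv : ∀ a : S, a ≠ 0 → ∃ b, a * b = 1) : MaxSemifield S :=
  open Classical in
  { (inferInstance : CommSemiring S) with
    exists_pair_ne := ⟨0, 1, h01⟩
    inv := fun a => if h : a = 0 then 0 else (hinv a h).choose
    inv_zero := dif_pos rfl
    mul_inv_cancel := fun a h => by
      classical
      change a * (if h : a = 0 then 0 else (hinv a h).choose) = 1
      rw [dif_neg h]
      exact (hinv a h).choose_spec
    nnqsmul := _
    nnqsmul_def := fun _ _ => rfl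
    le := fun a b => a + b = b
    le_refl := fun a => (hadd a a).elim id id
    le_trans := fun a b c (h : a + b = b) (h' : b + c = c) => by
      rw [← h', ← add_assoc, h]
    le_antisymm := fun a b (h : a + b = b) (h' : b + a = a) => by
      rw [← h', add_comm, h]
    le_total := fun a b => (hadd a b).symm.imp id fun h => by
      rw [add_comm, h]
    toDecidableLE := Classical.decRel _
    add_eq_max := fun a b => by
      classical
      change a + b = if a + b = b then b else a
      split_ifs with h
      · exact h
      · exact (hadd a b).resolve_right h }

/-! ### Transfer from the quotient -/

/-- Polynomials over the semiring† `R` are the nonzero polynomials over `R ∪ {0}`. -/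
theorem mainTheorem1 {L R : Type*} [SortingSemiring L] [CommSemiringDagger R]
    (D : QuasiLayeredDomain L R) (hD : D.IsLayeredOneSemifield) (hU : D.IsUniform)
    (f g h : (WithZero R)[X]) (hf : f ≠ 0) (hg : g ≠ 0) (hh : h ≠ 0) :
    D.NuEquivZero (layeredResultant f (g * h)) (layeredResultant f g * layeredResultant f h) ∧
      D.NuEquivZero (layeredResultant (f * g) h)
        (layeredResultant f h * layeredResultant g h) := by
  let C := QuasiLayeredDomain.nuCon hD.toIsLayeredDomain hU
  let φ : WithZero R →+* C.Quotient := C.mk'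
  have hφ : ∀ a b, φ a = φ b ↔ D.NuEquivZero a b := fun a b => RingCon.eq C
  have hsurj : Function.Surjective φ := RingCon.mk'_surjective C
  -- Only `0` is `ν`-equivalent to `0`; hence degrees, and so the sizes of Sylvester matrices,
  -- survive in the quotient.
  have hker : ∀ a, φ a = 0 → a = 0 := fun a ha => by
    rw [← map_zero φ, hφ] at ha
    cases ha
    rfl
  let _ : MaxSemifield C.Quotient := .ofBipotent
    (fun a b => by
      obtain ⟨a, rfl⟩ := hsurj a
      obtain ⟨b, rfl⟩ := hsurj b
      induction a using WithZero.recZeroCoe with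
      | zero => simp
      | coe a =>
        induction b using WithZero.recZeroCoe with
        | zero => simp
        | coe b =>
          rw [← map_add, hφ, hφ, ← WithZero.coe_add]
          exact (QuasiLayeredDomain.add_nuEquiv_or hD.toIsLayeredDomain a b).imp .coe .coe)
    (fun h => by
      rw [← map_one φ] at h
      exact absurd (hker 1 h.symm) WithZero.coe_ne_zero)
    (fun a ha => by
      obtain ⟨a, rfl⟩ := hsurj a
      induction a using WithZero.recZeroCoe with
      | zero => exact absurd (map_zero φ) ha
      | coe a =>
        obtain ⟨b, hb⟩ := QuasiLayeredDomain.exists_mul_nuEquiv_one hD hU a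
        refine ⟨φ b, ?_⟩
        rw [← map_mul, ← map_one φ, hφ, ← WithZero.coe_mul, ← WithZero.coe_one]
        exact .coe hb)
  have hmap : ∀ p : (WithZero R)[X], p ≠ 0 → p.map φ ≠ 0 := fun p hp hp0 => hp <| by
    ext n
    rw [coeff_zero]
    apply hker
    rw [← coeff_map, hp0, coeff_zero]
  rw [← hφ, ← hφ, map_mul, map_mul]
  simp only [← layeredResultant_map φ hker, Polynomial.map_mul]
  exact ⟨MaxSemifield.layeredResultant_mul_right _ _ _ (hmap f hf) (hmap g hg) (hmap h hh),
    MaxSemifield.layeredResultant_mul_left _ _ _ (hmap f hf) (hmap g hg) (hmap h hh)⟩
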